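/- Let $g:[0,1]\to\mathbb{R}^2$ be a rectifiable plane arc (a continuous curve of finite length) that is simple, i.e. injective. A pair of parallel support lines of $g$ consists of two parallel lines, both meeting $g([0,1])$, such that $g([0,1])$ lies in the closed strip between them (the two lines coincide exactly when $g([0,1])$ lies on one line parallel to them). Say that $g$ sits in the $\Lambda$-configuration in such a pair if there are parameters $r<s<t$ in $[0,1]$ such that $g(r)$ and $g(t)$ lie on one of the two lines and $g(s)$ lies on the other. Then there is exactly one (unordered) pair of parallel support lines in which $g$ sits in the $\Lambda$-configuration. -/

import Mathlib

/-- The Euclidean plane. -/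
abbrev Plane : Type := EuclideanSpace ℝ (Fin 2)

/-- `ℓ` is the support line of the set `K` with outer unit normal `u`: it is a line orthogonal to
`u`, it meets `K`, and `K` lies in the closed half-plane bounded by `ℓ` on the side opposite
to `u`. -/
def IsSupportLine (K : Set Plane) (u : Plane) (ℓ : Set Plane) : Prop :=
  ‖u‖ = 1 ∧ ∃ c : ℝ, ℓ = {x | inner ℝ u x = c} ∧
    (∀ p ∈ K, inner ℝ u p ≤ c) ∧ (ℓ ∩ K).Nonempty

/-- `ℓ₁` and `ℓ₂` are a pair of parallel support lines of `K`: support lines with opposite outer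
normals, so that `K` lies in the closed strip between them and touches both. (The two lines
coincide only if `K` lies in a single line.) -/
def IsParallelSupportPair (K : Set Plane) (ℓ₁ ℓ₂ : Set Plane) : Prop :=
  ∃ u : Plane, IsSupportLine K u ℓ₁ ∧ IsSupportLine K (-u) ℓ₂

/-- The curve `g` sits in the `Λ`-configuration in the unordered pair of lines `L`: the two
lines are a pair of parallel support lines of `g`, one of them contains points `g r` and `g t`, and
the other one contains a parametrically intermediate point `g s`, `r < s < t`. -/
def SitsInLambda (g : unitInterval → Plane) (L : Sym2 (Set Plane)) : Prop :=
  ∃ ℓ₁ ℓ₂ : Set Plane, L = s(ℓ₁, ℓ₂) ∧ IsParallelSupportPair (Set.range g) ℓ₁ ℓ₂ ∧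
    ∃ r s t : unitInterval, r < s ∧ s < t ∧ g r ∈ ℓ₁ ∧ g s ∈ ℓ₂ ∧ g t ∈ ℓ₁

/-- `g` is a rectifiable parametrized plane arc. -/
def IsRectifiableArc (g : unitInterval → Plane) : Prop :=
  Continuous g ∧ BoundedVariationOn g Set.univ

open Set

/-! Existence: if no direction gives a `Λ`, then for each unit `u` the parameters maximizing `⟪u, g
·⟫` either all precede or all follow the minimizing ones. The two alternatives are open and
exchanged by `u ↦ -u`, which contradicts connectedness of the circle (`exists_isLambda`).

Uniqueness: two `Λ`s in non-parallel directions become, after a linear change of coordinates, one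
for the real and one for the imaginary part. By injectivity the chords `G b - G a`, `a < b`, never
vanish, so they have a continuous argument on the convex set `orderedPairs`. Each `Λ` confines the
chords at its parameters to two adjacent half-turns (`exists_halfTurn_of_lambda`). Shared chords
make both half-turns of one `Λ` meet both of the other, which is impossible for pairs offset by a
quarter-turn (`not_lambda_re_and_lambda_im`). -/

/-! ### Continuous arguments and half-turns -/

/-- A nonvanishing continuous complex function on a nonempty convex set has a continuous argument
(measured here in multiples of `π`). -/
theorem Convex.exists_continuousOn_arg {E : Type*} [NormedAddCommGroup E] [NormedSpace ℝ E]
    {S : Set E} (hS : Convex ℝ S) (hne : S.Nonempty) {F : E → ℂ} (hF : ContinuousOn F S)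
    (h0 : ∀ p ∈ S, F p ≠ 0) :
    ∃ θ : E → ℝ, ContinuousOn θ S ∧ ∀ p ∈ S, ∃ ρ : ℝ, 0 < ρ ∧
      (F p).re = ρ * Real.cos (Real.pi * θ p) ∧ (F p).im = ρ * Real.sin (Real.pi * θ p) := by
  classical
  have := hS.contractibleSpace hne
  have := hS.locallyPathConnectedSpace
  obtain ⟨a₀, ha₀⟩ := hne
  let f : C(S, {z : ℂ // z ≠ 0}) := ⟨fun p => ⟨F p, h0 p p.2⟩,
    (continuousOn_iff_continuous_domRestrict.1 hF).subtype_mk _⟩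
  obtain ⟨L, ⟨-, hL⟩, -⟩ := Complex.isCoveringMap_exp.existsUnique_continuousMap_lifts f
    ⟨a₀, ha₀⟩ (Complex.log (F a₀)) (Subtype.ext (Complex.exp_log (h0 a₀ ha₀)))
  have hL' : ∀ p : S, Complex.exp (L p) = F p := fun p => congrArg Subtype.val (congrFun hL p)
  refine ⟨fun p => if hp : p ∈ S then (L ⟨p, hp⟩).im / Real.pi else 0, ?_, fun p hp => ?_⟩
  · rw [continuousOn_iff_continuous_domRestrict]
    have : S.domRestrict (fun p => if hp : p ∈ S then (L ⟨p, hp⟩).im / Real.pi else 0) =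
        fun p : S => (L p).im / Real.pi := by
      ext p; simp
    rw [this]
    fun_prop
  · refine ⟨Real.exp (L ⟨p, hp⟩).re, Real.exp_pos _, ?_⟩
    rw [← hL' ⟨p, hp⟩, Complex.exp_re, Complex.exp_im]
    simp [hp, mul_div_cancel₀ _ Real.pi_ne_zero]

theorem Real.exists_int_mem_Icc_of_cos_pi_mul_nonpos {y : ℝ} (hy : Real.cos (Real.pi * y) ≤ 0) :
    ∃ j : ℤ, y ∈ Icc (2 * j + 1 / 2 : ℝ) (2 * j + 3 / 2) := by
  have hpi := Real.pi_pos
  refine ⟨⌊y / 2⌋, ?_, ?_⟩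
  · by_contra! h
    have h1 := Int.floor_le (y / 2)
    have : 0 < Real.cos (Real.pi * y - ⌊y / 2⌋ * (2 * Real.pi)) :=
      Real.cos_pos_of_mem_Ioo ⟨by nlinarith, by nlinarith⟩
    rw [Real.cos_sub_int_mul_two_pi] at this
    linarith
  · by_contra! h
    have h1 := Int.lt_floor_add_one (y / 2)
    have : 0 < Real.cos (Real.pi * y - (⌊y / 2⌋ + 1 : ℤ) * (2 * Real.pi)) :=
      Real.cos_pos_of_mem_Ioo ⟨by push_cast; nlinarith, by push_cast; nlinarith⟩
    rw [Real.cos_sub_int_mul_two_pi] at this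
    linarith

/-- Changing half-turns would force `θ` through an even integer, where the cosine is `1`. -/
theorem IsPreconnected.exists_int_mem_Icc_of_cos_pi_mul_nonpos {X : Type*} [TopologicalSpace X]
    {S : Set X} (hS : IsPreconnected S) {θ : X → ℝ} (hθ : ContinuousOn θ S)
    (hcos : ∀ x ∈ S, Real.cos (Real.pi * θ x) ≤ 0) :
    ∃ j : ℤ, ∀ x ∈ S, θ x ∈ Icc (2 * j + 1 / 2 : ℝ) (2 * j + 3 / 2) := by
  have key : ∀ x ∈ S, ∀ y ∈ S, ∀ i j : ℤ, θ x ∈ Icc (2 * i + 1 / 2 : ℝ) (2 * i + 3 / 2) →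
      θ y ∈ Icc (2 * j + 1 / 2 : ℝ) (2 * j + 3 / 2) → j ≤ i := by
    intro x hx y hy i j hi hj
    by_contra! h
    have h' : (i + 1 : ℝ) ≤ j := by exact_mod_cast h
    obtain ⟨z, hz, hz'⟩ := hS.intermediate_value hx hy hθ
      (⟨by linarith [hi.2], by linarith [hj.1]⟩ : (2 * (i + 1) : ℝ) ∈ Icc (θ x) (θ y))
    have := hcos z hz
    rw [hz', show Real.pi * (2 * ((i : ℝ) + 1)) = ((i + 1 : ℤ) : ℝ) * (2 * Real.pi) by
      push_cast; ring, Real.cos_int_mul_two_pi] at this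
    linarith
  rcases S.eq_empty_or_nonempty with rfl | ⟨x, hx⟩
  · exact ⟨0, by simp⟩
  obtain ⟨j, hj⟩ := Real.exists_int_mem_Icc_of_cos_pi_mul_nonpos (hcos x hx)
  refine ⟨j, fun y hy => ?_⟩
  obtain ⟨i, hi⟩ := Real.exists_int_mem_Icc_of_cos_pi_mul_nonpos (hcos y hy)
  rwa [le_antisymm (key _ hy _ hx _ _ hi hj) (key _ hx _ hy _ _ hj hi)]

/-- The pairs of parameters `a < b` of the unit interval. -/
def orderedPairs : Set (ℝ × ℝ) := {p | 0 ≤ p.1 ∧ p.1 < p.2 ∧ p.2 ≤ 1}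

theorem convex_orderedPairs : Convex ℝ orderedPairs := by
  rintro ⟨a, b⟩ ⟨h1, h2, h3⟩ ⟨c, d⟩ ⟨h4, h5, h6⟩ x y hx hy hxy
  simp only [orderedPairs, mem_ofPred_eq, Prod.smul_mk, Prod.mk_add_mk, smul_eq_mul] at *
  refine ⟨by positivity, ?_, by nlinarith⟩
  rcases hx.eq_or_lt with rfl | hx
  · obtain rfl : y = 1 := by linarith
    simpa using h5
  · nlinarith

/-- If `θ` is a continuous argument function of the chords of a curve, and the coordinate `f` of
that curve in the direction of argument `φ` is maximal at `r` and `t` and minimal at `s`, where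
`r < s < t`, then the arguments of the chords that start in `r` or end in `s` lie in one half-turn,
and those of the chords that start in `s` or end in `t` in one of the two adjacent half-turns. -/
theorem exists_halfTurn_of_lambda {θ ρ : ℝ × ℝ → ℝ} {f : ℝ → ℝ} {φ r s t : ℝ}
    (hθ : ContinuousOn θ orderedPairs) (hρ : ∀ p ∈ orderedPairs, 0 < ρ p)
    (hf : ∀ p ∈ orderedPairs, f p.2 - f p.1 = ρ p * Real.cos (Real.pi * (θ p - φ)))
    (hr : 0 ≤ r) (hrs : r < s) (hst : s < t) (ht : t ≤ 1)
    (hmax : ∀ x ∈ Icc (0 : ℝ) 1, f x ≤ f r) (hrt : f t = f r)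
    (hmin : ∀ x ∈ Icc (0 : ℝ) 1, f s ≤ f x) :
    ∃ j e : ℤ, (e = 1 ∨ e = -1) ∧
      (∀ b, r < b → b ≤ 1 → θ (r, b) - φ ∈ Icc (2 * j + 1 / 2 : ℝ) (2 * j + 3 / 2)) ∧
      (∀ a, 0 ≤ a → a < s → θ (a, s) - φ ∈ Icc (2 * j + 1 / 2 : ℝ) (2 * j + 3 / 2)) ∧
      (∀ b, s < b → b ≤ 1 → θ (s, b) - φ ∈ Icc (2 * j + e + 1 / 2 : ℝ) (2 * j + e + 3 / 2)) ∧
      (∀ a, 0 ≤ a → a < t → θ (a, t) - φ ∈ Icc (2 * j + e + 1 / 2 : ℝ) (2 * j + e + 3 / 2)) := by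
  have nonpos : ∀ p ∈ orderedPairs, f p.2 ≤ f p.1 → Real.cos (Real.pi * (θ p - φ)) ≤ 0 := by
    intro p hp h
    by_contra! hc
    have := mul_pos (hρ p hp) hc
    linarith [hf p hp]
  -- Shifting by `1` flips the sign of the cosine, so rising chords fall under the same half-turn
  -- lemma.
  have nonneg : ∀ p ∈ orderedPairs, f p.1 ≤ f p.2 →
      Real.cos (Real.pi * (θ p - φ - 1)) ≤ 0 := by
    intro p hp h
    rw [mul_sub, mul_one, Real.cos_sub_pi]
    by_contra! hc
    have := mul_neg_of_pos_of_neg (hρ p hp) (neg_pos.1 hc)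
    linarith [hf p hp]
  have out : ∀ (a c : ℝ), 0 ≤ a → (∀ b, a < b → b ≤ 1 →
      Real.cos (Real.pi * (θ (a, b) - c)) ≤ 0) → ∃ j : ℤ, ∀ b, a < b → b ≤ 1 →
        θ (a, b) - c ∈ Icc (2 * j + 1 / 2 : ℝ) (2 * j + 3 / 2) := by
    intro a c ha h
    obtain ⟨j, hj⟩ := (isPreconnected_Ioc (a := a) (b := 1))
      |>.exists_int_mem_Icc_of_cos_pi_mul_nonpos (θ := fun b => θ (a, b) - c)
        ((hθ.comp (by fun_prop) fun b hb => ⟨ha, hb.1, hb.2⟩).sub continuousOn_const)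
        fun b hb => h b hb.1 hb.2
    exact ⟨j, fun b h1 h2 => hj b ⟨h1, h2⟩⟩
  have inc : ∀ (b c : ℝ), b ≤ 1 → (∀ a, 0 ≤ a → a < b →
      Real.cos (Real.pi * (θ (a, b) - c)) ≤ 0) → ∃ j : ℤ, ∀ a, 0 ≤ a → a < b →
        θ (a, b) - c ∈ Icc (2 * j + 1 / 2 : ℝ) (2 * j + 3 / 2) := by
    intro b c hb h
    obtain ⟨j, hj⟩ := (isPreconnected_Ico (a := 0) (b := b))
      |>.exists_int_mem_Icc_of_cos_pi_mul_nonpos (θ := fun a => θ (a, b) - c)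
        ((hθ.comp (by fun_prop) fun a ha => ⟨ha.1, ha.2, hb⟩).sub continuousOn_const)
        fun a ha => h a ha.1 ha.2
    exact ⟨j, fun a h1 h2 => hj a ⟨h1, h2⟩⟩
  obtain ⟨j₁, h₁⟩ := out r φ hr fun b h1 h2 =>
    nonpos (r, b) ⟨hr, h1, h2⟩ (hmax b ⟨by linarith, h2⟩)
  obtain ⟨j₂, h₂⟩ := inc s φ (by linarith) fun a h1 h2 =>
    nonpos (a, s) ⟨h1, h2, by linarith⟩ (hmin a ⟨h1, by linarith⟩)
  obtain ⟨j₃, h₃⟩ := out s (φ + 1) (by linarith) fun b h1 h2 => by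
    rw [← sub_sub]
    exact nonneg (s, b) ⟨by linarith, h1, h2⟩ (hmin b ⟨by linarith, h2⟩)
  obtain ⟨j₄, h₄⟩ := inc t (φ + 1) ht fun a h1 h2 => by
    rw [← sub_sub]
    exact nonneg (a, t) ⟨h1, h2, ht⟩ (hrt ▸ hmax a ⟨h1, by linarith⟩)
  -- The chord `(r, s)` identifies `j₁` with `j₂`, and `(s, t)` identifies `j₃` with `j₄`. The chord
  -- `(r, t)` lies in both remaining half-turns, so these are adjacent.
  have e₁ := h₁ s hrs (by linarith)
  have e₂ := h₂ r hr hrs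
  have e₃ := h₃ t hst ht
  have e₄ := h₄ s (by linarith) hst
  have e₅ := h₁ t (by linarith) ht
  have e₆ := h₄ r hr (by linarith)
  simp only [mem_Icc] at e₁ e₂ e₃ e₄ e₅ e₆
  have k₁ : j₁ < j₂ + 1 := by have : (j₁ : ℝ) < j₂ + 1 := by linarith
                              exact_mod_cast this
  have k₂ : j₂ < j₁ + 1 := by have : (j₂ : ℝ) < j₁ + 1 := by linarith
                              exact_mod_cast this
  have k₃ : j₃ < j₄ + 1 := by have : (j₃ : ℝ) < j₄ + 1 := by linarith
                              exact_mod_cast this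
  have k₄ : j₄ < j₃ + 1 := by have : (j₄ : ℝ) < j₃ + 1 := by linarith
                              exact_mod_cast this
  have k₅ : j₄ < j₁ + 1 := by have : (j₄ : ℝ) < j₁ + 1 := by linarith
                              exact_mod_cast this
  have k₆ : j₁ < j₄ + 2 := by have : (j₁ : ℝ) < j₄ + 2 := by linarith
                              exact_mod_cast this
  obtain rfl : j₂ = j₁ := by omega
  obtain rfl : j₃ = j₄ := by omega
  refine ⟨j₂, 2 * (j₃ - j₂) + 1, by omega, h₁, h₂, fun b hb hb' => ?_, fun a ha ha' => ?_⟩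
  · have := h₃ b hb hb'
    push_cast
    constructor <;> linarith [this.1, this.2]
  · have := h₄ a ha ha'
    push_cast
    constructor <;> linarith [this.1, this.2]

/-- No injective plane curve is in the Λ-configuration both for the first and for the second
coordinate. -/
theorem not_lambda_re_and_lambda_im {G : ℝ → ℂ} (hG : ContinuousOn G (Icc 0 1))
    (hinj : InjOn G (Icc 0 1)) {r s t r' s' t' : ℝ}
    (hr : 0 ≤ r) (hrs : r < s) (hst : s < t) (ht : t ≤ 1)
    (hmax : ∀ x ∈ Icc (0 : ℝ) 1, (G x).re ≤ (G r).re) (hrt : (G t).re = (G r).re)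
    (hmin : ∀ x ∈ Icc (0 : ℝ) 1, (G s).re ≤ (G x).re)
    (hr' : 0 ≤ r') (hrs' : r' < s') (hst' : s' < t') (ht' : t' ≤ 1)
    (hmax' : ∀ x ∈ Icc (0 : ℝ) 1, (G x).im ≤ (G r').im) (hrt' : (G t').im = (G r').im)
    (hmin' : ∀ x ∈ Icc (0 : ℝ) 1, (G s').im ≤ (G x).im) : False := by
  have hfst : ∀ p ∈ orderedPairs, p.1 ∈ Icc (0 : ℝ) 1 := fun p hp =>
    ⟨hp.1, by linarith [hp.2.1, hp.2.2]⟩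
  have hsnd : ∀ p ∈ orderedPairs, p.2 ∈ Icc (0 : ℝ) 1 := fun p hp =>
    ⟨by linarith [hp.1, hp.2.1], hp.2.2⟩
  obtain ⟨θ, hθ, hθG⟩ := convex_orderedPairs.exists_continuousOn_arg
    ⟨((0 : ℝ), (1 : ℝ)), by simp [orderedPairs]⟩ (F := fun p => G p.2 - G p.1)
    ((hG.comp continuousOn_snd hsnd).sub (hG.comp continuousOn_fst hfst))
    (fun p hp => sub_ne_zero.2 fun h => hp.2.1.ne (hinj (hsnd p hp) (hfst p hp) h).symm)
  choose! ρ hρ hre him using hθG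
  obtain ⟨j, e, he, h₁, h₂, h₃, h₄⟩ := exists_halfTurn_of_lambda (f := fun x => (G x).re) (φ := 0)
    hθ hρ (fun p hp => by simpa using hre p hp) hr hrs hst ht hmax hrt hmin
  -- The imaginary part is the coordinate in direction `π / 2`, hence `φ = 1 / 2`.
  obtain ⟨k, e', he', h₁', h₂', h₃', h₄'⟩ := exists_halfTurn_of_lambda (f := fun x => (G x).im)
    (φ := 1 / 2) hθ hρ (fun p hp => by
      rw [mul_sub, mul_one_div, Real.cos_sub_pi_div_two]; simpa using him p hp)
    hr' hrs' hst' ht' hmax' hrt' hmin'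
  have compat : ∀ {X Y : ℤ} (p : ℝ × ℝ), θ p - 0 ∈ Icc (X + 1 / 2 : ℝ) (X + 3 / 2) →
      θ p - 1 / 2 ∈ Icc (Y + 1 / 2 : ℝ) (Y + 3 / 2) → Y ≤ X ∧ X < Y + 2 := by
    intro X Y p hX hY
    have hYX : (Y : ℝ) < X + 1 := by linarith [hX.2, hY.1]
    have hXY : (X : ℝ) < Y + 2 := by linarith [hX.1, hY.2]
    norm_cast at hYX hXY
    exact ⟨by omega, hXY⟩
  -- Every half-turn of the first kind meets every half-turn of the second kind.
  have false_of : (∃ p : ℝ × ℝ, θ p - 0 ∈ Icc (2 * j + 1 / 2 : ℝ) (2 * j + 3 / 2) ∧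
        θ p - 1 / 2 ∈ Icc (2 * k + 1 / 2 : ℝ) (2 * k + 3 / 2)) →
      (∃ p : ℝ × ℝ, θ p - 0 ∈ Icc (2 * j + 1 / 2 : ℝ) (2 * j + 3 / 2) ∧
        θ p - 1 / 2 ∈ Icc (2 * k + e' + 1 / 2 : ℝ) (2 * k + e' + 3 / 2)) →
      (∃ p : ℝ × ℝ, θ p - 0 ∈ Icc (2 * j + e + 1 / 2 : ℝ) (2 * j + e + 3 / 2) ∧
        θ p - 1 / 2 ∈ Icc (2 * k + 1 / 2 : ℝ) (2 * k + 3 / 2)) →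
      (∃ p : ℝ × ℝ, θ p - 0 ∈ Icc (2 * j + e + 1 / 2 : ℝ) (2 * j + e + 3 / 2) ∧
        θ p - 1 / 2 ∈ Icc (2 * k + e' + 1 / 2 : ℝ) (2 * k + e' + 3 / 2)) → False := by
    rintro ⟨p, hp, hp'⟩ ⟨q, hq, hq'⟩ ⟨v, hv, hv'⟩ ⟨w, hw, hw'⟩
    have c₁ := compat (X := 2 * j) (Y := 2 * k) p (by exact_mod_cast hp) (by exact_mod_cast hp')
    have c₂ := compat (X := 2 * j) (Y := 2 * k + e') q (by exact_mod_cast hq)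
      (by exact_mod_cast hq')
    have c₃ := compat (X := 2 * j + e) (Y := 2 * k) v (by exact_mod_cast hv)
      (by exact_mod_cast hv')
    have c₄ := compat (X := 2 * j + e) (Y := 2 * k + e') w (by exact_mod_cast hw)
      (by exact_mod_cast hw')
    -- Both `2 * j` and `2 * j + e` would lie in `{2 * k, 2 * k + 1}` and in its translate by `e' =
    -- ±1`; these share only one integer.
    omega
  -- The order of `s` and `s'` decides which chords belong to both configurations. If they coincide,
  -- the chords from `0` and to `1` serve for two of the four pairs.
  rcases lt_trichotomy s s' with h | rfl | h
  · exact false_of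
      ⟨(r, s'), h₁ s' (by linarith) (by linarith), h₂' r hr (by linarith)⟩
      ⟨(r, t'), h₁ t' (by linarith) ht', h₄' r hr (by linarith)⟩
      ⟨(s, s'), h₃ s' h (by linarith), h₂' s (by linarith) h⟩
      ⟨(s, t'), h₃ t' (by linarith) ht', h₄' s (by linarith) (by linarith)⟩
  · exact false_of
      ⟨(0, s), h₂ 0 le_rfl (by linarith), h₂' 0 le_rfl (by linarith)⟩
      ⟨(r, t'), h₁ t' (by linarith) ht', h₄' r hr (by linarith)⟩
      ⟨(r', t), h₄ r' hr' (by linarith), h₁' t (by linarith) ht⟩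
      ⟨(s, 1), h₃ 1 (by linarith) le_rfl, h₃' 1 (by linarith) le_rfl⟩
  · exact false_of
      ⟨(r', s), h₂ r' hr' (by linarith), h₁' s (by linarith) (by linarith)⟩
      ⟨(s', s), h₂ s' (by linarith) h, h₃' s h (by linarith)⟩
      ⟨(r', t), h₄ r' hr' (by linarith), h₁' t (by linarith) ht⟩
      ⟨(s', t), h₄ s' (by linarith) (by linarith), h₃' t (by linarith) ht⟩

/-! ### Existence of a `Λ`-direction -/

/-- The curve `g` touches its support line with outer normal `u` at the parameters `r` and `t`, and
the opposite one at the intermediate parameter `s`. -/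
def IsLambda (g : unitInterval → Plane) (u : Plane) (r s t : unitInterval) : Prop :=
  r < s ∧ s < t ∧ (∀ x, inner ℝ u (g x) ≤ inner ℝ u (g r)) ∧
    inner ℝ u (g t) = inner ℝ u (g r) ∧ ∀ x, inner ℝ u (g s) ≤ inner ℝ u (g x)

theorem sitsInLambda_iff {g : unitInterval → Plane} {L : Sym2 (Set Plane)} :
    SitsInLambda g L ↔ ∃ u : Plane, ‖u‖ = 1 ∧ ∃ r s t, IsLambda g u r s t ∧
      L = s({x | inner ℝ u x = inner ℝ u (g r)}, {x | inner ℝ (-u) x = inner ℝ (-u) (g s)}) := by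
  constructor
  · rintro ⟨ℓ₁, ℓ₂, rfl, ⟨u, ⟨hu, c, rfl, hc, -⟩, ⟨-, d, rfl, hd, -⟩⟩, r, s, t, hrs, hst, hr, hs, ht⟩
    rw [Set.mem_ofPred_eq] at hr hs ht
    refine ⟨u, hu, r, s, t, ⟨hrs, hst, fun x => hr ▸ hc _ ⟨x, rfl⟩, ht.trans hr.symm, fun x => ?_⟩,
      by rw [hr, hs]⟩
    have := hs ▸ hd _ ⟨x, rfl⟩
    simpa only [inner_neg_left, neg_le_neg_iff] using this
  · rintro ⟨u, hu, r, s, t, ⟨hrs, hst, hmax, hrt, hmin⟩, rfl⟩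
    refine ⟨_, _, rfl, ⟨u, ⟨hu, _, rfl, ?_, g r, rfl, r, rfl⟩,
      ⟨by rwa [norm_neg], _, rfl, ?_, g s, rfl, s, rfl⟩⟩, r, s, t, hrs, hst, rfl, rfl, hrt⟩
    · rintro _ ⟨x, rfl⟩
      exact hmax x
    · rintro _ ⟨x, rfl⟩
      simpa only [inner_neg_left, neg_le_neg_iff] using hmin x

/-- The directions `u` for which every parameter at which `⟪u, g ·⟫` is maximal precedes every
parameter at which it is minimal. -/
def maxBeforeMin (g : unitInterval → Plane) : Set Plane :=
  {u | ∀ r s : unitInterval, (∀ x, inner ℝ u (g x) ≤ inner ℝ u (g r)) →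
    (∀ x, inner ℝ u (g s) ≤ inner ℝ u (g x)) → r < s}

/-- The complement is the projection, along the compact square of parameters, of a closed set. -/
theorem isOpen_maxBeforeMin {g : unitInterval → Plane} (hg : Continuous g) :
    IsOpen (maxBeforeMin g) := by
  have h₁ : IsClosed {p : Plane × (unitInterval × unitInterval) |
      ∀ x, inner ℝ p.1 (g x) ≤ inner ℝ p.1 (g p.2.1)} := by
    rw [Set.ofPred_forall]
    exact isClosed_iInter fun x => isClosed_le (by fun_prop) (by fun_prop)
  have h₂ : IsClosed {p : Plane × (unitInterval × unitInterval) |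
      ∀ x, inner ℝ p.1 (g p.2.2) ≤ inner ℝ p.1 (g x)} := by
    rw [Set.ofPred_forall]
    exact isClosed_iInter fun x => isClosed_le (by fun_prop) (by fun_prop)
  have h₃ : IsClosed {p : Plane × (unitInterval × unitInterval) | p.2.2 ≤ p.2.1} :=
    isClosed_le (by fun_prop) (by fun_prop)
  rw [← isClosed_compl_iff]
  convert isClosedMap_fst_of_compactSpace _ (h₁.inter (h₂.inter h₃)) using 1
  ext u
  simp only [maxBeforeMin, Set.mem_compl_iff, Set.mem_ofPred_eq, Set.mem_image, Prod.exists,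
    exists_and_right, exists_eq_right]
  push Not
  rfl

/-- A minimum between two maxima is a `Λ` for `u`, and a maximum between two minima is one for `-u`.
Without either, maxima and minima cannot interleave. -/
theorem mem_maxBeforeMin_or_neg_mem {g : unitInterval → Plane} (hg : Continuous g) {u : Plane}
    (h : ∀ r s t, ¬ IsLambda g u r s t) (h' : ∀ r s t, ¬ IsLambda g (-u) r s t) :
    (u ∈ maxBeforeMin g ∨ -u ∈ maxBeforeMin g) ∧ ¬ (u ∈ maxBeforeMin g ∧ -u ∈ maxBeforeMin g) := by
  have hcont : Continuous fun x => (inner ℝ u (g x) : ℝ) := by fun_prop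
  obtain ⟨a, -, ha⟩ := isCompact_univ.exists_isMaxOn Set.univ_nonempty hcont.continuousOn
  obtain ⟨b, -, hb⟩ := isCompact_univ.exists_isMinOn Set.univ_nonempty hcont.continuousOn
  replace ha : ∀ x, inner ℝ u (g x) ≤ inner ℝ u (g a) := fun x => ha (Set.mem_univ x)
  replace hb : ∀ x, inner ℝ u (g b) ≤ inner ℝ u (g x) := fun x => hb (Set.mem_univ x)
  simp only [IsLambda, inner_neg_left, neg_le_neg_iff, neg_inj] at h h'
  simp only [maxBeforeMin, Set.mem_ofPred_eq, inner_neg_left, neg_le_neg_iff]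
  have ne : ∀ r s : unitInterval, (∀ x, inner ℝ u (g x) ≤ inner ℝ u (g r)) →
      (∀ x, inner ℝ u (g s) ≤ inner ℝ u (g x)) → r ≠ s := by
    rintro r _ hr hs rfl
    -- A common maximum and minimum makes the coordinate constant, and then `0 < 1 / 2 < 1` is
    -- already a `Λ`.
    have hconst : ∀ x, inner ℝ u (g x) = inner ℝ u (g r) := fun x => le_antisymm (hr x) (hs x)
    refine h 0 ⟨1 / 2, by norm_num, by norm_num⟩ 1 ⟨?_, ?_, ?_, ?_, ?_⟩
    · rw [← Subtype.coe_lt_coe]; norm_num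
    · rw [← Subtype.coe_lt_coe]; norm_num
    all_goals simp [hconst]
  have side₁ : ∀ a b c : unitInterval, (∀ x, inner ℝ u (g x) ≤ inner ℝ u (g a)) →
      (∀ x, inner ℝ u (g b) ≤ inner ℝ u (g x)) → (∀ x, inner ℝ u (g x) ≤ inner ℝ u (g c)) →
      a < b → c < b := fun a b c ha hb hc hab =>
    lt_of_not_ge fun hbc => h a b c ⟨hab, hbc.lt_of_ne (ne c b hc hb).symm, ha,
      le_antisymm (ha c) (hc a), hb⟩
  have side₂ : ∀ a b c : unitInterval, (∀ x, inner ℝ u (g a) ≤ inner ℝ u (g x)) →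
      (∀ x, inner ℝ u (g x) ≤ inner ℝ u (g b)) → (∀ x, inner ℝ u (g c) ≤ inner ℝ u (g x)) →
      a < b → c < b := fun a b c ha hb hc hab =>
    lt_of_not_ge fun hbc => h' a b c ⟨hab, hbc.lt_of_ne (ne b c hb hc), ha,
      le_antisymm (hc a) (ha c), hb⟩
  refine ⟨?_, fun H => (H.1 a b ha hb).not_gt (H.2 b a hb ha)⟩
  rcases lt_or_gt_of_ne (ne a b ha hb) with hab | hab
  · refine .inl fun r s hr hs => ?_
    have hrb := side₁ a b r ha hb hr hab
    exact lt_of_not_ge fun hsr => (side₂ s r b hs hr hb (hsr.lt_of_ne (ne r s hr hs).symm)).not_gt hrb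
  · refine .inr fun s r hs hr => ?_
    have hsa := side₂ b a s hb ha hs hab
    exact lt_of_not_ge fun hrs => (side₁ r s a hr hs ha (hrs.lt_of_ne (ne r s hr hs))).not_gt hsa

theorem exists_isLambda {g : unitInterval → Plane} (hg : Continuous g) :
    ∃ u : Plane, ‖u‖ = 1 ∧ ∃ r s t, IsLambda g u r s t := by
  by_contra! h
  have key : ∀ u ∈ Metric.sphere (0 : Plane) 1, _ := fun u hu =>
    mem_maxBeforeMin_or_neg_mem hg (h u (by simpa using hu)) (h (-u) (by simpa using hu))
  have hconn : IsPreconnected (Metric.sphere (0 : Plane) 1) := by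
    refine isPreconnected_sphere ?_ _ _
    rw [← Module.finrank_eq_rank, finrank_euclideanSpace_fin]
    norm_num
  have hneg : IsOpen {u | -u ∈ maxBeforeMin g} := (isOpen_maxBeforeMin hg).preimage continuous_neg
  obtain ⟨u₀, hu₀⟩ := NormedSpace.sphere_nonempty (x := (0 : Plane)) (r := 1) |>.2 zero_le_one
  have hu₀' : -u₀ ∈ Metric.sphere (0 : Plane) 1 := by simpa using hu₀
  have ne₁ : (Metric.sphere (0 : Plane) 1 ∩ maxBeforeMin g).Nonempty := by
    rcases (key u₀ hu₀).1 with h | h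
    exacts [⟨u₀, hu₀, h⟩, ⟨-u₀, hu₀', h⟩]
  have ne₂ : (Metric.sphere (0 : Plane) 1 ∩ {u | -u ∈ maxBeforeMin g}).Nonempty := by
    obtain ⟨u, hu, hu'⟩ := ne₁
    exact ⟨-u, by simpa using hu, by simpa using hu'⟩
  obtain ⟨u, hu, h₁, h₂⟩ := hconn _ _ (isOpen_maxBeforeMin hg) hneg (fun u hu => (key u hu).1)
    ne₁ ne₂
  exact (key u hu).2 ⟨h₁, h₂⟩

/-! ### Uniqueness of the direction, and the theorem -/

theorem eq_or_eq_neg_of_det_eq_zero {u v : Plane} (hu : ‖u‖ = 1) (hv : ‖v‖ = 1)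
    (h : u 0 * v 1 - u 1 * v 0 = 0) : v = u ∨ v = -u := by
  rw [EuclideanSpace.norm_eq, Real.sqrt_eq_one, Fin.sum_univ_two] at hu hv
  simp only [Real.norm_eq_abs, sq_abs] at hu hv
  have h₀ : v 0 = (u 0 * v 0 + u 1 * v 1) * u 0 := by linear_combination -v 0 * hu - u 1 * h
  have h₁ : v 1 = (u 0 * v 0 + u 1 * v 1) * u 1 := by linear_combination -v 1 * hu + u 0 * h
  have hc : (u 0 * v 0 + u 1 * v 1) ^ 2 = 1 := by
    linear_combination (v 0 ^ 2 + v 1 ^ 2) * hu + hv - (u 0 * v 1 - u 1 * v 0) * h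
  rcases (sq_eq_sq_iff_eq_or_eq_neg.1 (hc.trans (one_pow 2).symm)) with hc | hc
  · left
    ext i
    fin_cases i
    · simpa [hc] using h₀
    · simpa [hc] using h₁
  · right
    ext i
    fin_cases i
    · simpa [hc] using h₀
    · simpa [hc] using h₁

theorem IsLambda.eq_or_eq_neg {g : unitInterval → Plane} (hg : Continuous g)
    (hinj : Function.Injective g) {u v : Plane} (hu : ‖u‖ = 1) (hv : ‖v‖ = 1)
    {r s t r' s' t' : unitInterval} (h : IsLambda g u r s t) (h' : IsLambda g v r' s' t') :
    v = u ∨ v = -u := by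
  refine eq_or_eq_neg_of_det_eq_zero hu hv ?_
  by_contra hdet
  let G : ℝ → ℂ := fun x => ⟨inner ℝ u (g (Set.projIcc 0 1 zero_le_one x)),
    inner ℝ v (g (Set.projIcc 0 1 zero_le_one x))⟩
  have hG : Continuous G := by
    have h₁ : Continuous fun x : ℝ => g (Set.projIcc 0 1 zero_le_one x) :=
      hg.comp continuous_projIcc
    have h₂ : Continuous fun x : ℝ =>
        ((inner ℝ u (g (Set.projIcc 0 1 zero_le_one x)),
          inner ℝ v (g (Set.projIcc 0 1 zero_le_one x))) : ℝ × ℝ) := by fun_prop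
    exact Complex.equivRealProdCLM.symm.continuous.comp h₂
  have hGinj : Set.InjOn G (Set.Icc 0 1) := by
    intro x hx y hy hxy
    have h₁ := congrArg Complex.re hxy
    have h₂ := congrArg Complex.im hxy
    simp only [G, Set.projIcc_of_mem _ hx, Set.projIcc_of_mem _ hy, PiLp.inner_apply,
      Fin.sum_univ_two, RCLike.inner_apply, conj_trivial] at h₁ h₂
    have : g ⟨x, hx⟩ = g ⟨y, hy⟩ := by
      ext i
      -- Cramer's rule recovers the coordinates of `g` from the two inner products.
      apply mul_left_cancel₀ hdet
      fin_cases i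
      · simp only [Fin.zero_eta]; linear_combination v 1 * h₁ - u 1 * h₂
      · simp only [Fin.mk_one]; linear_combination u 0 * h₂ - v 0 * h₁
    exact congrArg Subtype.val (hinj this)
  have hGre : ∀ x : unitInterval, (G x).re = inner ℝ u (g x) := fun x => by simp [G]
  have hGim : ∀ x : unitInterval, (G x).im = inner ℝ v (g x) := fun x => by simp [G]
  obtain ⟨hrs, hst, hmax, hrt, hmin⟩ := h
  obtain ⟨hrs', hst', hmax', hrt', hmin'⟩ := h'
  refine not_lambda_re_and_lambda_im hG.continuousOn hGinj
    (r := r) (s := s) (t := t) (r' := r') (s' := s') (t' := t')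
    r.2.1 hrs hst t.2.2 (fun x hx => ?_) ?_ (fun x hx => ?_)
    r'.2.1 hrs' hst' t'.2.2 (fun x hx => ?_) ?_ (fun x hx => ?_)
  · exact (hGre ⟨x, hx⟩).trans_le ((hmax _).trans_eq (hGre r).symm)
  · rw [hGre, hGre, hrt]
  · exact (hGre s).trans_le ((hmin _).trans_eq (hGre ⟨x, hx⟩).symm)
  · exact (hGim ⟨x, hx⟩).trans_le ((hmax' _).trans_eq (hGim r').symm)
  · rw [hGim, hGim, hrt']
  · exact (hGim s').trans_le ((hmin' _).trans_eq (hGim ⟨x, hx⟩).symm)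

theorem mainTheorem2 (g : unitInterval → Plane) (hg : IsRectifiableArc g)
    (hsimple : Function.Injective g) :
    ∃! L : Sym2 (Set Plane), SitsInLambda g L := by
  obtain ⟨u, hu, r, s, t, h⟩ := exists_isLambda hg.1
  refine ⟨_, sitsInLambda_iff.2 ⟨u, hu, r, s, t, h, rfl⟩, fun L hL => ?_⟩
  obtain ⟨v, hv, r', s', t', h', rfl⟩ := sitsInLambda_iff.1 hL
  have huv := h.eq_or_eq_neg hg.1 hsimple hu hv h'
  obtain ⟨-, -, hmax, -, hmin⟩ := h
  obtain ⟨-, -, hmax', -, hmin'⟩ := h'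
  rcases huv with rfl | rfl
  · rw [le_antisymm (hmax r') (hmax' r), inner_neg_left, inner_neg_left,
      le_antisymm (hmin' s) (hmin s')]
  -- Passing from `u` to `-u` exchanges maxima and minima, hence the two lines; the pair is
  -- unordered.
  · simp only [inner_neg_left, neg_le_neg_iff, neg_neg, neg_inj] at hmax' hmin' ⊢
    rw [le_antisymm (hmax' s) (hmin r'), le_antisymm (hmax s') (hmin' r), Sym2.eq_swap]
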